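/- **Setting.** Let $A\in\mathbb R^{d_x\times d_x}$, $B\in\mathbb R^{d_x\times d_w}$, $C_y\in\mathbb R^{d_y\times d_x}$, $C_s\in\mathbb R^{d_s\times d_x}$ and consider $x_{t+1}=Ax_t+Bw_t$, $y_t=C_yx_t+v_t$, $s_t=C_sx_t$. Fix a horizon $T\ge 1$ and a radius $\rho_T>0$. Stack $\mathbf y_T=[y_0;\dots;y_{T-1}]$, $\mathbf s_T=[s_0;\dots;s_{T-1}]$, $\mathbf w_T=[x_0;w_0;\dots;w_{T-2}]$, $\mathbf v_T=[v_0;\dots;v_{T-1}]$ and $\xi_T=[\mathbf w_T;\mathbf v_T]$, so that $\mathbf y_T=\mathcal H_T\mathbf w_T+\mathbf v_T$ and $\mathbf s_T=\mathcal L_T\mathbf w_T$, where block row $t$ of $\mathcal H_T$ (resp. $\mathcal L_T$) is $[CA^t,\ CA^{t-1}B,\ \dots,\ CAB,\ CB,\ 0,\dots,0]$ with $C=C_y$ (resp. $C=C_s$). Let $\mathscr K_T$ be the set of real $Td_s\times Td_y$ matrices that are block lower-triangular (with $d_s\times d_y$ blocks). For a real $Td_s\times Td_y$ matrix $\mathcal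 K$ let $\mathcal T_{\mathcal K}=[\mathcal K\mathcal H_T-\mathcal L_T,\ \mathcal K]$, so that $\mathcal T_{\mathcal K}\xi_T=\mathcal K\mathbf y_T-\mathbf s_T$ is the estimation error. Let $\mathbb P^\circ_T$ be a Borel probability measure with finite second moments on the space of disturbances $\xi_T$, with $\mathbb E_{\mathbb P^\circ_T}[\xi_T\xi_T^*]=I$. Let $\mathcal W_T$ be the set of probability measures $\mathbb P$ with finite second moments and $\mathsf W_2(\mathbb P,\mathbb P^\circ_T)\le\rho_T$, where $\mathsf W_2$ is the Wasserstein-2 distance for the Euclidean norm, and let $$\mathsf E_T(\mathcal K)=\sup_{\mathbb P\in\mathcal W_T}\mathbb E_{\mathbb P}\|\mathcal T_{\mathcal K}\xi_T\|^2 .$$ The *filtering problem* is $\inf_{\mathcal K\in\mathscr K_T}\mathsf E_T(\mathcal K)$. Put $\mathcal K_T^\circ=\mathcal L_T\mathcal H_T^*(I+\mathcal H_T\mathcal H_T^*)^{-1}$ and $G=\mathcal L_T(I+\mathcal H_T^*\mathcal H_T)^{-1}\mathcal L_T^*$ (which is $\mathcal T_{\mathcal K_T^\circ}\mathcal T_{\mathcal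 K_T^\circ}^*$). **Theorem.** Consider the semidefinite program $$\inf_{\mathcal K\in\mathscr K_T,\ \gamma\ge0,\ \mathcal X\succeq0}\ \gamma\,(\rho_T^2-\operatorname{Tr} I_{Td_s})+\operatorname{Tr}\mathcal X\quad\text{s.t.}\quad\begin{bmatrix}\mathcal X&\gamma I&0\\ \gamma I&\gamma I-G&\mathcal K-\mathcal K_T^\circ\\ 0&(\mathcal K-\mathcal K_T^\circ)^*&(I+\mathcal H_T\mathcal H_T^*)^{-1}\end{bmatrix}\succeq0 .$$ 1. The filtering problem and the semidefinite program have the same optimal value. The semidefinite program has an optimal solution. A matrix $\mathcal K$ solves the filtering problem (that is, $\mathcal K\in\mathscr K_T$ and $\mathcal K$ minimizes $\mathsf E_T$ over $\mathscr K_T$) if and only if $(\mathcal K,\gamma,\mathcal X)$ is an optimal solution of the semidefinite program for some $\gamma,\mathcal X$. 2. Let $(\mathcal K_\star,\gamma_\star,\mathcal X_\star)$ be any optimal solution of the semidefinite program. If $C_s\ne0$, then $\gamma_\star>0$. If $\gamma_\star>0$, then $I-\gamma_\star^{-1}\mathcal T_{\mathcal K_\star}^*\mathcal T_{\mathcal K_\star}$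 is positive definite, and for $\xi^\circ\sim\mathbb P_T^\circ$ the law of $$\xi^\star=(I-\gamma_\star^{-1}\mathcal T_{\mathcal K_\star}^*\mathcal T_{\mathcal K_\star})^{-1}\xi^\circ$$ belongs to $\mathcal W_T$ and attains the supremum defining $\mathsf E_T(\mathcal K_\star)$. -/

import Mathlib

open MeasureTheory
open scoped ENNReal Matrix

noncomputable section

namespace DRFilter

/-- Data of the state-space model
`x (t+1) = A x t + B w t`, `y t = Cy x t + v t`, `s t = Cs x t`. -/
structure StateSpace (dx dw dy ds : ℕ) where
  A : Matrix (Fin dx) (Fin dx) ℝ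
  B : Matrix (Fin dx) (Fin dw) ℝ
  Cy : Matrix (Fin dy) (Fin dx) ℝ
  Cs : Matrix (Fin ds) (Fin dx) ℝ

/-- Coordinates of a stacked signal `[u 0; …; u (T-1)]` with `u t ∈ ℝ^d`. -/
abbrev SigIdx (T d : ℕ) : Type := Fin T × Fin d

/-- Coordinates of the stacked process noise `w_T = [x 0; w 0; …; w (T-2)]`. -/
abbrev ProcIdx (T dx dw : ℕ) : Type := Fin dx ⊕ (Fin (T - 1) × Fin dw)

/-- Coordinates of the stacked disturbance `ξ_T = [w_T; v_T]`. -/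
abbrev DistIdx (T dx dw dy : ℕ) : Type := ProcIdx T dx dw ⊕ SigIdx T dy

/-- The block lower-triangular matrix that sends `[x 0; w 0; …; w (T-2)]` to
`[C x 0; …; C x (T-1)]`, where `x (t+1) = A x t + B w t`. Its block row `t` is
`[C A^t, C A^(t-1) B, …, C A B, C B, 0, …, 0]`. -/
def outputMatrix (T : ℕ) {dx dw p : ℕ} (A : Matrix (Fin dx) (Fin dx) ℝ)
    (B : Matrix (Fin dx) (Fin dw) ℝ) (C : Matrix (Fin p) (Fin dx) ℝ) :
    Matrix (SigIdx T p) (ProcIdx T dx dw) ℝ :=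
  Matrix.of fun r c =>
    match c with
    | Sum.inl j => (C * A ^ (r.1 : ℕ)) r.2 j
    | Sum.inr (k, j) =>
        if (k : ℕ) < (r.1 : ℕ) then
          (C * A ^ ((r.1 : ℕ) - 1 - (k : ℕ)) * B) r.2 j
        else 0

section Model

variable {dx dw dy ds : ℕ} (S : StateSpace dx dw dy ds) (T : ℕ)

/-- The measurement operator `H_T`: `y_T = H_T w_T + v_T`. -/
def measOp : Matrix (SigIdx T dy) (ProcIdx T dx dw) ℝ := outputMatrix T S.A S.B S.Cy

/-- The target operator `L_T`: `s_T = L_T w_T`. -/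
def targetOp : Matrix (SigIdx T ds) (ProcIdx T dx dw) ℝ := outputMatrix T S.A S.B S.Cs

/-- The error transfer operator `[K H_T - L_T, K]`, which sends the disturbance `ξ_T` to the
estimation error `ŝ_T - s_T` of the linear estimator `ŝ_T = K y_T`. -/
def errorOp (K : Matrix (SigIdx T ds) (SigIdx T dy) ℝ) :
    Matrix (SigIdx T ds) (DistIdx T dx dw dy) ℝ :=
  Matrix.fromCols (K * measOp S T - targetOp S T) K

/-- The non-causal estimator `L_T H_Tᵀ (I + H_T H_Tᵀ)⁻¹`. -/
def noncausalEstimator : Matrix (SigIdx T ds) (SigIdx T dy) ℝ :=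
  targetOp S T * (measOp S T)ᵀ * (1 + measOp S T * (measOp S T)ᵀ)⁻¹

/-- The matrix `L_T (I + H_Tᵀ H_T)⁻¹ L_Tᵀ`. -/
def noncausalErrorGram : Matrix (SigIdx T ds) (SigIdx T ds) ℝ :=
  targetOp S T * (1 + (measOp S T)ᵀ * measOp S T)⁻¹ * (targetOp S T)ᵀ

end Model

/-- The block lower-triangular (causal) linear filters. -/
def causalFilters (T dy ds : ℕ) : Set (Matrix (SigIdx T ds) (SigIdx T dy) ℝ) :=
  {K | ∀ (t s : Fin T) (i : Fin ds) (j : Fin dy), t < s → K (t, i) (s, j) = 0}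

section Wasserstein

variable {ι : Type*} [Fintype ι]

/-- Probability measures on `ℝ^ι` with finite second moment. -/
def Prob2 (P : Measure (EuclideanSpace ℝ ι)) : Prop :=
  IsProbabilityMeasure P ∧ MemLp id 2 P

/-- Couplings of `P` and `Q`: measures on the product with marginals `P` and `Q`. -/
def couplings (P Q : Measure (EuclideanSpace ℝ ι)) :
    Set (Measure (EuclideanSpace ℝ ι × EuclideanSpace ℝ ι)) :=
  {π | π.map Prod.fst = P ∧ π.map Prod.snd = Q}

/-- The Wasserstein-2 distance for the Euclidean norm. -/
def W2 (P Q : Measure (EuclideanSpace ℝ ι)) : ℝ≥0∞ :=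
  (⨅ π ∈ couplings P Q, ∫⁻ z, edist z.1 z.2 ^ 2 ∂π) ^ (1 / 2 : ℝ)

/-- The Wasserstein-2 ambiguity ball of radius `ρ` around `P₀`. -/
def ambiguitySet (P₀ : Measure (EuclideanSpace ℝ ι)) (ρ : ℝ) :
    Set (Measure (EuclideanSpace ℝ ι)) :=
  {P | Prob2 P ∧ W2 P P₀ ≤ ENNReal.ofReal ρ}

end Wasserstein

section Problem

variable {dx dw dy ds : ℕ} (S : StateSpace dx dw dy ds) (T : ℕ)

/-- The mean-squared error of the estimator `K` when the disturbance has law `P`. -/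
def mse (K : Matrix (SigIdx T ds) (SigIdx T dy) ℝ)
    (P : Measure (EuclideanSpace ℝ (DistIdx T dx dw dy))) : ℝ≥0∞ :=
  ∫⁻ ξ, ‖Matrix.toEuclideanLin (errorOp S T K) ξ‖ₑ ^ 2 ∂P

/-- The worst-case mean-squared error of the estimator `K` over the ambiguity ball. -/
def worstCaseMSE (P₀ : Measure (EuclideanSpace ℝ (DistIdx T dx dw dy))) (ρ : ℝ)
    (K : Matrix (SigIdx T ds) (SigIdx T dy) ℝ) : ℝ≥0∞ :=
  ⨆ P ∈ ambiguitySet P₀ ρ, mse S T K P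

/-- `K` solves the distributionally robust filtering problem: it is causal and has the least
worst-case mean-squared error among the causal linear filters. -/
def IsOptimalFilter (P₀ : Measure (EuclideanSpace ℝ (DistIdx T dx dw dy))) (ρ : ℝ)
    (K : Matrix (SigIdx T ds) (SigIdx T dy) ℝ) : Prop :=
  K ∈ causalFilters T dy ds ∧
    ∀ K' ∈ causalFilters T dy ds, worstCaseMSE S T P₀ ρ K ≤ worstCaseMSE S T P₀ ρ K'

/-- The block matrix of the linear matrix inequality
```
[ X      γ I       0                ]
[ γ I    γ I - G   K - K₀           ]
[ 0      (K - K₀)ᵀ (I + H_T H_Tᵀ)⁻¹ ]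
```
with `K₀` the non-causal estimator and `G = L_T (I + H_Tᵀ H_T)⁻¹ L_Tᵀ`. -/
def lmiMatrix (K : Matrix (SigIdx T ds) (SigIdx T dy) ℝ) (γ : ℝ)
    (X : Matrix (SigIdx T ds) (SigIdx T ds) ℝ) :
    Matrix (SigIdx T ds ⊕ (SigIdx T ds ⊕ SigIdx T dy))
      (SigIdx T ds ⊕ (SigIdx T ds ⊕ SigIdx T dy)) ℝ :=
  Matrix.fromBlocks
    X (Matrix.fromCols (γ • 1) 0)
    (Matrix.fromRows (γ • 1) 0)
    (Matrix.fromBlocks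
      (γ • 1 - noncausalErrorGram S T) (K - noncausalEstimator S T)
      (K - noncausalEstimator S T)ᵀ (1 + measOp S T * (measOp S T)ᵀ)⁻¹)

/-- The constraints of the semidefinite program. -/
def SDPFeasible (K : Matrix (SigIdx T ds) (SigIdx T dy) ℝ) (γ : ℝ)
    (X : Matrix (SigIdx T ds) (SigIdx T ds) ℝ) : Prop :=
  K ∈ causalFilters T dy ds ∧ 0 ≤ γ ∧ X.PosSemidef ∧ (lmiMatrix S T K γ X).PosSemidef

/-- The objective `γ (ρ² - Tr I) + Tr X` of the semidefinite program. -/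
def sdpObjective {T ds : ℕ} (ρ γ : ℝ) (X : Matrix (SigIdx T ds) (SigIdx T ds) ℝ) : ℝ :=
  γ * (ρ ^ 2 - (1 : Matrix (SigIdx T ds) (SigIdx T ds) ℝ).trace) + X.trace

/-- `(K, γ, X)` is an optimal solution of the semidefinite program. -/
def SDPOptimal (ρ : ℝ) (K : Matrix (SigIdx T ds) (SigIdx T dy) ℝ) (γ : ℝ)
    (X : Matrix (SigIdx T ds) (SigIdx T ds) ℝ) : Prop :=
  SDPFeasible S T K γ X ∧
    ∀ K' γ' X', SDPFeasible S T K' γ' X' → sdpObjective ρ γ X ≤ sdpObjective ρ γ' X'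

/-- The matrix `I - γ⁻¹ T_Kᵀ T_K`, with `T_K` the error transfer operator of `K`. -/
def shiftMatrix (K : Matrix (SigIdx T ds) (SigIdx T dy) ℝ) (γ : ℝ) :
    Matrix (DistIdx T dx dw dy) (DistIdx T dx dw dy) ℝ :=
  1 - γ⁻¹ • ((errorOp S T K)ᵀ * errorOp S T K)

/-- The law of `(I - γ⁻¹ T_Kᵀ T_K)⁻¹ ξ₀` when `ξ₀` has law `P₀`. -/
def worstCaseLaw (P₀ : Measure (EuclideanSpace ℝ (DistIdx T dx dw dy)))
    (K : Matrix (SigIdx T ds) (SigIdx T dy) ℝ) (γ : ℝ) :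
    Measure (EuclideanSpace ℝ (DistIdx T dx dw dy)) :=
  P₀.map (Matrix.toEuclideanLin (shiftMatrix S T K γ)⁻¹)

end Problem

end DRFilter

end

/-! Fix a filter with error operator `E` and put `N = E * Eᵀ`, `R = (γ • 1 - N)⁻¹`. Pricing
transport at `γ`, with `γ • 1 - N` positive definite, and completing the square bounds the
worst-case error by `dualValue N ρ γ`: `sq_error_le` is the pointwise bound, and integrating it
along couplings gives `lintegral_enorm_sq_le_of_mem_ambiguitySet`. The maximizing displacement is
linear, `D = Eᵀ * R * E`, and `1 + D` is the inverse of `1 - γ⁻¹ • (Eᵀ * E)`. Its cost under an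
isotropic nominal law is the trace of `(N * R)²`. If `N ≠ 0`, `exists_multiplier` finds a `γ` making
this cost exactly `ρ ^ 2`; the shifted law then lies in the ball and attains the bound, so there is
no duality gap (`worstCaseMSE_eq_dualValue`).

On the program side, completing the square in `K` (`errorOp_mul_transpose`) and one Schur complement
reduce the linear matrix inequality to a block matrix in `X`, `γ` and `N`. For `γ > 0` a second
Schur complement gives `X ⪰ γ² R`, so the least objective at fixed `K` and `γ` is the dual value; `γ
= 0` is feasible only when `E = 0`. Thus each feasible point bounds the error of its filter, and
each causal filter has a feasible point with equality, which identifies values and minimizers.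

Existence follows from lower semicontinuity and coercivity of the worst-case error. The dual
function has a unique minimizer (`multiplier_unique`), so every optimal solution with `γ > 0` has a
stationary multiplier, and its shifted law is extremal. -/

namespace DRFilter

/-! ### The scalar dual problem, in an eigenbasis. -/

section Spectral

variable {m : Type*} [Fintype m] [DecidableEq m] {N : Matrix m m ℝ}

theorem exists_orthogonal_diagonalization (hN : N.PosSemidef) :
    ∃ (U : Matrix m m ℝ) (lam : m → ℝ), Uᵀ * U = 1 ∧ U * Uᵀ = 1 ∧
      N = U * Matrix.diagonal lam * Uᵀ ∧ ∀ i, 0 ≤ lam i := by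
  have hU := hN.1.eigenvectorUnitary.2
  refine ⟨hN.1.eigenvectorUnitary, hN.1.eigenvalues, ?_, ?_, ?_, hN.eigenvalues_nonneg⟩
  · simpa [Matrix.star_eq_conjTranspose] using Matrix.mem_unitaryGroup_iff'.1 hU
  · simpa [Matrix.star_eq_conjTranspose] using Matrix.mem_unitaryGroup_iff.1 hU
  · conv_lhs => rw [hN.1.spectral_theorem]
    simp [Unitary.conjStarAlgAut_apply, Matrix.star_eq_conjTranspose]

section Diag

variable {U : Matrix m m ℝ} {lam : m → ℝ}

theorem conj_diagonal_mul (h1 : Uᵀ * U = 1) (a b : m → ℝ) :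
    (U * Matrix.diagonal a * Uᵀ) * (U * Matrix.diagonal b * Uᵀ) =
      U * Matrix.diagonal (fun i => a i * b i) * Uᵀ := by
  rw [← Matrix.diagonal_mul_diagonal]
  calc _ = U * Matrix.diagonal a * (Uᵀ * U) * Matrix.diagonal b * Uᵀ := by
        simp only [Matrix.mul_assoc]
    _ = _ := by rw [h1]; simp only [Matrix.mul_assoc, Matrix.mul_one]

theorem trace_conj_diagonal (h1 : Uᵀ * U = 1) (a : m → ℝ) :
    (U * Matrix.diagonal a * Uᵀ).trace = ∑ i, a i := by
  rw [Matrix.trace_mul_comm, ← Matrix.mul_assoc, h1, Matrix.one_mul, Matrix.trace_diagonal]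

theorem smul_one_sub_conj_diagonal (h2 : U * Uᵀ = 1) (γ : ℝ) :
    γ • (1 : Matrix m m ℝ) - U * Matrix.diagonal lam * Uᵀ =
      U * Matrix.diagonal (fun i => γ - lam i) * Uᵀ := by
  have : Matrix.diagonal (fun i => γ - lam i) = γ • (1 : Matrix m m ℝ) - Matrix.diagonal lam := by
    rw [← Matrix.diagonal_one, ← Matrix.diagonal_smul, Matrix.diagonal_sub]
    congr 1; ext i; simp
  rw [this, Matrix.mul_sub, Matrix.sub_mul]
  simp [h2]

theorem posDef_smul_one_sub_conj_diagonal_iff (h2 : U * Uᵀ = 1) (γ : ℝ) :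
    (γ • (1 : Matrix m m ℝ) - U * Matrix.diagonal lam * Uᵀ).PosDef ↔ ∀ i, lam i < γ := by
  have hu : IsUnit U := IsUnit.of_mul_eq_one Uᵀ h2
  have := Matrix.IsUnit.posDef_star_right_conjugate_iff (x := Matrix.diagonal fun i => γ - lam i) hu
  rw [Matrix.star_eq_conjTranspose, Matrix.conjTranspose_eq_transpose_of_trivial] at this
  rw [smul_one_sub_conj_diagonal h2, this, Matrix.posDef_diagonal_iff]
  simp

theorem inv_smul_one_sub_conj_diagonal (h1 : Uᵀ * U = 1) (h2 : U * Uᵀ = 1) {γ : ℝ}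
    (h : ∀ i, lam i < γ) :
    (γ • (1 : Matrix m m ℝ) - U * Matrix.diagonal lam * Uᵀ)⁻¹ =
      U * Matrix.diagonal (fun i => (γ - lam i)⁻¹) * Uᵀ := by
  apply Matrix.inv_eq_right_inv
  rw [smul_one_sub_conj_diagonal h2, conj_diagonal_mul h1]
  have : (fun i => (γ - lam i) * (γ - lam i)⁻¹) = fun _ => 1 := by
    ext i; exact mul_inv_cancel₀ (sub_pos.2 (h i)).ne'
  rw [this, Matrix.diagonal_one, Matrix.mul_one, h2]

end Diag

/-- The worst-case multiplier: the stationarity equation of the scalar dual is solvable. -/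
theorem exists_multiplier (hN : N.PosSemidef) (h0 : N ≠ 0) {ρ : ℝ} (hρ : 0 < ρ) :
    ∃ γ : ℝ, 0 < γ ∧ (γ • 1 - N).PosDef ∧
      ((N * (γ • 1 - N)⁻¹) * (N * (γ • 1 - N)⁻¹)).trace = ρ ^ 2 := by
  obtain ⟨U, lam, h1, h2, rfl, hl⟩ := exists_orthogonal_diagonalization hN
  have hne : ∃ j, lam j ≠ 0 := by
    by_contra! hc
    apply h0
    rw [show lam = fun _ => 0 from funext hc, Matrix.diagonal_zero]
    simp
  obtain ⟨j₀, hj₀⟩ := hne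
  obtain ⟨j, -, hj⟩ := Finset.exists_max_image Finset.univ lam ⟨j₀, Finset.mem_univ _⟩
  have hjpos : 0 < lam j :=
    lt_of_lt_of_le (lt_of_le_of_ne (hl j₀) hj₀.symm) (hj j₀ (Finset.mem_univ _))
  set g : ℝ → ℝ := fun γ => ∑ i, (lam i * (γ - lam i)⁻¹) ^ 2 with hg
  set Q : ℝ := ∑ i, lam i ^ 2 with hQ
  have hjQ : lam j ^ 2 ≤ Q :=
    Finset.single_le_sum (f := fun i => lam i ^ 2) (fun i _ => sq_nonneg _) (Finset.mem_univ j)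
  have hs : lam j ≤ √Q := Real.le_sqrt_of_sq_le hjQ
  have hspos : 0 < √Q := lt_of_lt_of_le hjpos hs
  have hQpos : 0 < Q := Real.sqrt_pos.1 hspos
  have hlo : 0 < lam j / ρ := div_pos hjpos hρ
  -- Bracket for the root of `g γ = ρ ^ 2` above the largest eigenvalue `lam j`. At the lower end
  -- the `j`-th term alone equals `ρ ^ 2`; at the upper end every gap `γ - lam i` is at least `√Q /
  -- ρ`, so the sum is at most `ρ ^ 2`.
  have hle : lam j + lam j / ρ ≤ lam j + √Q / ρ := by gcongr
  have hcont : ContinuousOn g (Set.Icc (lam j + lam j / ρ) (lam j + √Q / ρ)) := by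
    refine continuousOn_finsetSum _ fun i _ => ?_
    refine ((continuousOn_const).mul (ContinuousOn.inv₀ (by fun_prop) ?_)).pow 2
    intro x hx
    have := hj i (Finset.mem_univ _)
    have := hx.1
    exact ne_of_gt (by linarith)
  have hglo : ρ ^ 2 ≤ g (lam j + lam j / ρ) := by
    have : (lam j * (lam j + lam j / ρ - lam j)⁻¹) ^ 2 = ρ ^ 2 := by
      rw [add_sub_cancel_left]; field_simp
    rw [← this]
    exact Finset.single_le_sum
      (f := fun i => (lam i * (lam j + lam j / ρ - lam i)⁻¹) ^ 2)
      (fun i _ => sq_nonneg _) (Finset.mem_univ j)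
  have hghi : g (lam j + √Q / ρ) ≤ ρ ^ 2 := by
    have hb : ∀ i, (lam i * (lam j + √Q / ρ - lam i)⁻¹) ^ 2 ≤ lam i ^ 2 * (ρ ^ 2 / Q) := by
      intro i
      have h3 : √Q / ρ ≤ lam j + √Q / ρ - lam i := by
        have := hj i (Finset.mem_univ _); linarith
      have h4 : 0 < √Q / ρ := div_pos hspos hρ
      have h5 : (lam j + √Q / ρ - lam i)⁻¹ ≤ (√Q / ρ)⁻¹ := by gcongr
      have h6 : 0 ≤ (lam j + √Q / ρ - lam i)⁻¹ := inv_nonneg.2 (h4.le.trans h3)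
      calc (lam i * (lam j + √Q / ρ - lam i)⁻¹) ^ 2
          = lam i ^ 2 * (lam j + √Q / ρ - lam i)⁻¹ ^ 2 := mul_pow _ _ _
        _ ≤ lam i ^ 2 * ((√Q / ρ)⁻¹) ^ 2 := by gcongr
        _ = _ := by rw [inv_div, div_pow, Real.sq_sqrt hQpos.le]
    calc g (lam j + √Q / ρ) ≤ ∑ i, lam i ^ 2 * (ρ ^ 2 / Q) := Finset.sum_le_sum fun i _ => hb i
      _ = ρ ^ 2 := by rw [← Finset.sum_mul, ← hQ]; field_simp
  obtain ⟨γ, hγ, hγg⟩ := intermediate_value_Icc' hle hcont ⟨hghi, hglo⟩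
  have hlt : ∀ i, lam i < γ := fun i => by
    have := hj i (Finset.mem_univ _); have := hγ.1; linarith
  refine ⟨γ, hjpos.trans (hlt j), (posDef_smul_one_sub_conj_diagonal_iff h2 γ).2 hlt, ?_⟩
  rw [inv_smul_one_sub_conj_diagonal h1 h2 hlt, conj_diagonal_mul h1, conj_diagonal_mul h1,
    trace_conj_diagonal h1, ← hγg, hg]
  exact Finset.sum_congr rfl fun i _ => (sq _).symm

/-- The scalar dual objective has at most one minimizer. -/
theorem multiplier_unique (hN : N.PosSemidef) {ρ γ γ' : ℝ} (hρ : 0 < ρ)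
    (hγ : (γ • 1 - N).PosDef) (hγ' : (γ' • 1 - N).PosDef)
    (hst : ((N * (γ' • 1 - N)⁻¹) * (N * (γ' • 1 - N)⁻¹)).trace = ρ ^ 2)
    (hle : γ * ρ ^ 2 + γ * (N * (γ • 1 - N)⁻¹).trace ≤
      γ' * ρ ^ 2 + γ' * (N * (γ' • 1 - N)⁻¹).trace) : γ = γ' := by
  obtain ⟨U, lam, h1, h2, rfl, hl⟩ := exists_orthogonal_diagonalization hN
  have hlt := (posDef_smul_one_sub_conj_diagonal_iff h2 γ).1 hγ
  have hlt' := (posDef_smul_one_sub_conj_diagonal_iff h2 γ').1 hγ'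
  rw [inv_smul_one_sub_conj_diagonal h1 h2 hlt', conj_diagonal_mul h1, conj_diagonal_mul h1,
    trace_conj_diagonal h1] at hst
  rw [inv_smul_one_sub_conj_diagonal h1 h2 hlt', inv_smul_one_sub_conj_diagonal h1 h2 hlt,
    conj_diagonal_mul h1, conj_diagonal_mul h1, trace_conj_diagonal h1,
    trace_conj_diagonal h1] at hle
  -- Replacing `ρ ^ 2` by its value at the stationary `γ'` turns the difference of dual values into
  -- exactly `(γ - γ') ^ 2 * W`, with no remainder. This gives uniqueness without any calculus.
  set W : ℝ := ∑ i, lam i ^ 2 * ((γ' - lam i)⁻¹) ^ 2 * (γ - lam i)⁻¹ with hW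
  have hid : γ * ρ ^ 2 + γ * ∑ i, lam i * (γ - lam i)⁻¹ -
      (γ' * ρ ^ 2 + γ' * ∑ i, lam i * (γ' - lam i)⁻¹) = (γ - γ') ^ 2 * W := by
    rw [← hst, hW, Finset.mul_sum, Finset.mul_sum, Finset.mul_sum, Finset.mul_sum,
      Finset.mul_sum, ← Finset.sum_add_distrib, ← Finset.sum_add_distrib,
      ← Finset.sum_sub_distrib]
    refine Finset.sum_congr rfl fun i _ => ?_
    have a := (sub_pos.2 (hlt i)).ne'
    have b := (sub_pos.2 (hlt' i)).ne'
    field_simp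
    ring
  have hterm : ∀ i, 0 ≤ lam i ^ 2 * ((γ' - lam i)⁻¹) ^ 2 * (γ - lam i)⁻¹ := fun i =>
    mul_nonneg (by positivity) (inv_nonneg.2 (sub_pos.2 (hlt i)).le)
  have hWpos : 0 < W := by
    -- If `W` vanished, every term of the stationarity sum would vanish too, contradicting `ρ > 0`.
    refine lt_of_le_of_ne (Finset.sum_nonneg fun i _ => hterm i) fun hz => ?_
    have hzero := (Finset.sum_eq_zero_iff_of_nonneg fun i _ => hterm i).1 hz.symm
    have : (0 : ℝ) = ρ ^ 2 := by
      rw [← hst]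
      symm
      refine Finset.sum_eq_zero fun i hi => ?_
      have := hzero i hi
      have hne := inv_ne_zero (sub_pos.2 (hlt i)).ne'
      have h3 := (mul_eq_zero.1 this).resolve_right hne
      rw [← h3]; ring
    exact (by positivity : ρ ^ 2 ≠ 0) this.symm
  have h4 : (γ - γ') ^ 2 * W ≤ 0 := by rw [← hid]; linarith
  have h5 : (γ - γ') ^ 2 ≤ 0 := by
    by_contra! h
    exact absurd (mul_pos h hWpos) (not_lt.2 h4)
  have h6 : (γ - γ') ^ 2 = 0 := le_antisymm h5 (sq_nonneg _)
  exact sub_eq_zero.1 (pow_eq_zero_iff (two_ne_zero) |>.1 h6)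

end Spectral

/-! ### Resolvent identities and the pointwise Lagrangian bound. -/

section Resolvent

variable {m n : Type*} [Fintype m] [DecidableEq m] [Fintype n]
  {N : Matrix m m ℝ} {E : Matrix m n ℝ} {γ : ℝ}

theorem mul_resolvent (h : (γ • 1 - N).PosDef) :
    N * (γ • 1 - N)⁻¹ = γ • (γ • 1 - N)⁻¹ - 1 := by
  have := Matrix.mul_nonsing_inv _ ((Matrix.isUnit_iff_isUnit_det _).1 h.isUnit)
  rw [Matrix.sub_mul, Matrix.smul_mul, Matrix.one_mul] at this
  exact (sub_eq_of_eq_add' (sub_eq_iff_eq_add.1 this)).symm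

theorem resolvent_transpose (h : (γ • 1 - N).PosDef) :
    ((γ • 1 - N)⁻¹)ᵀ = (γ • 1 - N)⁻¹ := by
  have := h.inv.1
  rwa [Matrix.IsHermitian, Matrix.conjTranspose_eq_transpose_of_trivial] at this

theorem trace_mul_resolvent (h : (γ • 1 - N).PosDef) :
    (N * (γ • 1 - N)⁻¹).trace =
      γ * ((γ • 1 - N)⁻¹).trace - (1 : Matrix m m ℝ).trace := by
  rw [mul_resolvent h, Matrix.trace_sub, Matrix.trace_smul, smul_eq_mul]

/-- Transport cost of the shift `(1 - γ⁻¹ EᵀE)⁻¹`. -/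
theorem trace_shift_cost (h : (γ • 1 - E * Eᵀ).PosDef) :
    ((Eᵀ * (γ • 1 - E * Eᵀ)⁻¹ * E) * (Eᵀ * (γ • 1 - E * Eᵀ)⁻¹ * E)ᵀ).trace =
      ((E * Eᵀ * (γ • 1 - E * Eᵀ)⁻¹) * (E * Eᵀ * (γ • 1 - E * Eᵀ)⁻¹)).trace := by
  rw [Matrix.transpose_mul, Matrix.transpose_mul, Matrix.transpose_transpose,
    resolvent_transpose h]
  calc _ = (Eᵀ * ((γ • 1 - E * Eᵀ)⁻¹ * (E * Eᵀ) * (γ • 1 - E * Eᵀ)⁻¹ * E)).trace := by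
        simp only [Matrix.mul_assoc]
    _ = _ := by
        rw [Matrix.trace_mul_comm, ← Matrix.trace_mul_comm (E * Eᵀ * (γ • 1 - E * Eᵀ)⁻¹),
          Matrix.trace_mul_comm]
        simp only [Matrix.mul_assoc]
        rw [Matrix.trace_mul_comm]
        simp only [Matrix.mul_assoc]
        rw [Matrix.trace_mul_comm]
        simp only [Matrix.mul_assoc]

variable [DecidableEq n]

/-- A Woodbury identity: the inverse on the large disturbance space is expressed by the resolvent on
the small error space, and is visibly the identity plus a displacement. -/
theorem shift_mul_resolvent (hγ : γ ≠ 0) (h : (γ • 1 - E * Eᵀ).PosDef) :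
    (1 - γ⁻¹ • (Eᵀ * E)) * (1 + Eᵀ * (γ • 1 - E * Eᵀ)⁻¹ * E) = 1 := by
  have h1 : Eᵀ * E * (Eᵀ * (γ • 1 - E * Eᵀ)⁻¹ * E) =
      γ • (Eᵀ * (γ • 1 - E * Eᵀ)⁻¹ * E) - Eᵀ * E := by
    calc _ = Eᵀ * (E * Eᵀ * (γ • 1 - E * Eᵀ)⁻¹) * E := by simp only [Matrix.mul_assoc]
      _ = _ := by
        rw [mul_resolvent h, Matrix.mul_sub, Matrix.sub_mul, Matrix.mul_smul, Matrix.smul_mul,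
          Matrix.mul_one]
  rw [Matrix.sub_mul, Matrix.one_mul, Matrix.smul_mul, Matrix.mul_add, Matrix.mul_one, h1,
    add_sub_cancel, smul_smul, inv_mul_cancel₀ hγ, one_smul, add_sub_cancel_right]

theorem inv_shift (hγ : γ ≠ 0) (h : (γ • 1 - E * Eᵀ).PosDef) :
    (1 - γ⁻¹ • (Eᵀ * E))⁻¹ = 1 + Eᵀ * (γ • 1 - E * Eᵀ)⁻¹ * E :=
  Matrix.inv_eq_right_inv (shift_mul_resolvent hγ h)

theorem posDef_shift (hγ : γ ≠ 0) (h : (γ • 1 - E * Eᵀ).PosDef) :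
    (1 - γ⁻¹ • (Eᵀ * E)).PosDef := by
  rw [← Matrix.posDef_inv_iff, inv_shift hγ h]
  have := h.inv.posSemidef.conjTranspose_mul_mul_same E
  rw [Matrix.conjTranspose_eq_transpose_of_trivial] at this
  exact Matrix.PosDef.one.add_posSemidef this

theorem mul_inv_shift (h : (γ • 1 - E * Eᵀ).PosDef) :
    E * (1 + Eᵀ * (γ • 1 - E * Eᵀ)⁻¹ * E) = γ • ((γ • 1 - E * Eᵀ)⁻¹ * E) := by
  have : E * (Eᵀ * (γ • 1 - E * Eᵀ)⁻¹ * E) = E * Eᵀ * (γ • 1 - E * Eᵀ)⁻¹ * E := by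
    simp only [Matrix.mul_assoc]
  rw [Matrix.mul_add, this, mul_resolvent h, Matrix.sub_mul, Matrix.smul_mul, Matrix.mul_one,
    Matrix.one_mul, add_sub_cancel]

/-- Cost of the shifted disturbance, at a stationary multiplier. -/
theorem trace_shift_error (h : (γ • 1 - E * Eᵀ).PosDef) :
    (E * (1 + Eᵀ * (γ • 1 - E * Eᵀ)⁻¹ * E) * (E * (1 + Eᵀ * (γ • 1 - E * Eᵀ)⁻¹ * E))ᵀ).trace =
      γ * (((E * Eᵀ * (γ • 1 - E * Eᵀ)⁻¹) * (E * Eᵀ * (γ • 1 - E * Eᵀ)⁻¹)).trace +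
        (E * Eᵀ * (γ • 1 - E * Eᵀ)⁻¹).trace) := by
  have h2 : (E * Eᵀ * (γ • 1 - E * Eᵀ)⁻¹) * (E * Eᵀ * (γ • 1 - E * Eᵀ)⁻¹) =
      γ • (E * Eᵀ * (γ • 1 - E * Eᵀ)⁻¹ * (γ • 1 - E * Eᵀ)⁻¹) -
        E * Eᵀ * (γ • 1 - E * Eᵀ)⁻¹ := by
    conv_lhs => rw [mul_resolvent (N := E * Eᵀ) h, Matrix.mul_sub, Matrix.mul_one,
      ← mul_resolvent (N := E * Eᵀ) h, Matrix.mul_smul]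
  rw [mul_inv_shift h, h2, Matrix.transpose_smul, Matrix.transpose_mul, resolvent_transpose h,
    Matrix.trace_sub, Matrix.trace_smul, sub_add_cancel, Matrix.smul_mul, Matrix.mul_smul,
    Matrix.trace_smul, Matrix.trace_smul, smul_eq_mul, smul_eq_mul, smul_eq_mul]
  congr 2
  rw [Matrix.trace_mul_comm (E * Eᵀ * (γ • 1 - E * Eᵀ)⁻¹)]
  simp only [Matrix.mul_assoc]

/-- Lagrangian bound: the worst-case gain of moving `z` to `x` at unit price `γ`. -/
theorem sq_error_le (h : (γ • 1 - E * Eᵀ).PosDef) (hγ : 0 < γ) (x z : n → ℝ) :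
    (E *ᵥ x) ⬝ᵥ (E *ᵥ x) ≤ γ * ((x - z) ⬝ᵥ (x - z)) +
      γ * (z ⬝ᵥ ((Eᵀ * (γ • 1 - E * Eᵀ)⁻¹ * E) *ᵥ z)) := by
  set R := (γ • 1 - E * Eᵀ)⁻¹ with hR
  set u := E *ᵥ z with hu
  set r := R *ᵥ u with hr
  -- `Eᵀ *ᵥ r` is the optimal displacement of `z`, and `y` is the deviation from it. The cross terms
  -- in `y` cancel, and the slack of the inequality is the quantity in `hpos`.
  set y := x - z - Eᵀ *ᵥ r with hy
  have hNR : E *ᵥ (Eᵀ *ᵥ r) = γ • r - u := by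
    rw [hr, Matrix.mulVec_mulVec, Matrix.mulVec_mulVec, hR, mul_resolvent h,
      Matrix.sub_mulVec, Matrix.smul_mulVec, Matrix.one_mulVec]
  have hadj : ∀ (a : m → ℝ) (b : n → ℝ), (Eᵀ *ᵥ a) ⬝ᵥ b = a ⬝ᵥ (E *ᵥ b) := fun a b => by
    rw [Matrix.mulVec_transpose, Matrix.dotProduct_mulVec]
  have hx : x = z + Eᵀ *ᵥ r + y := by rw [hy]; abel
  have hEx : E *ᵥ x = γ • r + E *ᵥ y := by
    rw [hx, Matrix.mulVec_add, Matrix.mulVec_add, hNR]; abel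
  have hxz : x - z = Eᵀ *ᵥ r + y := by rw [hy]; abel
  have hz : z ⬝ᵥ ((Eᵀ * R * E) *ᵥ z) = r ⬝ᵥ u := by
    rw [← Matrix.mulVec_mulVec, ← Matrix.mulVec_mulVec, dotProduct_comm, hadj]
  have hpos : 0 ≤ γ * (y ⬝ᵥ y) - (E *ᵥ y) ⬝ᵥ (E *ᵥ y) := by
    have := (posDef_shift hγ.ne' h).posSemidef.dotProduct_mulVec_nonneg y
    rw [star_trivial, Matrix.sub_mulVec, Matrix.one_mulVec, Matrix.smul_mulVec,
      dotProduct_sub, dotProduct_smul, ← Matrix.mulVec_mulVec, dotProduct_comm y (Eᵀ *ᵥ _),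
      hadj, smul_eq_mul] at this
    have h3 := mul_nonneg hγ.le this
    rwa [mul_sub, ← mul_assoc, mul_inv_cancel₀ hγ.ne', one_mul] at h3
  have hrr : (Eᵀ *ᵥ r) ⬝ᵥ (Eᵀ *ᵥ r) = γ * (r ⬝ᵥ r) - r ⬝ᵥ u := by
    rw [hadj, hNR, dotProduct_sub, dotProduct_smul, smul_eq_mul]
  rw [hEx, hxz, hz]
  simp only [add_dotProduct, dotProduct_add, smul_dotProduct, dotProduct_smul, smul_eq_mul, hrr,
    hadj, dotProduct_comm y (Eᵀ *ᵥ r), dotProduct_comm (E *ᵥ y) r]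
  nlinarith [hpos]

end Resolvent

/-! ### Second moments, couplings and the Wasserstein ball. -/

section Moments

variable {m n : Type*} [Fintype m] [Fintype n]
  {P : Measure (EuclideanSpace ℝ n)}

/-- The matrix of second moments. -/
noncomputable def secondMoment (P : Measure (EuclideanSpace ℝ n)) : Matrix n n ℝ :=
  Matrix.of fun i j => ∫ ξ, ξ i * ξ j ∂P

theorem Prob2.integrable_mul (hP : Prob2 P) (i j : n) : Integrable (fun ξ => ξ i * ξ j) P :=
  (MemLp.eval_piLp hP.2 i).integrable_mul (MemLp.eval_piLp hP.2 j)

/-- Semidefiniteness makes the integrand nonnegative, so the extended integral agrees with the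
Bochner integral and can be expanded entrywise. -/
theorem lintegral_quadratic (hP : Prob2 P) {Q : Matrix n n ℝ} (hQ : Q.PosSemidef) :
    ∫⁻ ξ, ENNReal.ofReal (ξ.ofLp ⬝ᵥ (Q *ᵥ ξ.ofLp)) ∂P =
      ENNReal.ofReal (Q * secondMoment P).trace := by
  have hint : ∀ i j, Integrable (fun ξ : EuclideanSpace ℝ n => Q i j * (ξ i * ξ j)) P :=
    fun i j => (hP.integrable_mul i j).const_mul _
  have hexp : (fun ξ : EuclideanSpace ℝ n => ξ.ofLp ⬝ᵥ (Q *ᵥ ξ.ofLp)) =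
      fun ξ => ∑ i, ∑ j, Q i j * (ξ i * ξ j) := by
    ext ξ
    simp only [dotProduct, Matrix.mulVec, Finset.mul_sum]
    exact Finset.sum_congr rfl fun i _ => Finset.sum_congr rfl fun j _ => by ring
  rw [← ofReal_integral_eq_lintegral_ofReal]
  · congr 1
    rw [hexp, integral_finsetSum _ fun i _ => integrable_finsetSum _ fun j _ => hint i j]
    simp only [Matrix.trace, Matrix.diag, Matrix.mul_apply]
    refine Finset.sum_congr rfl fun i _ => ?_
    rw [integral_finsetSum _ fun j _ => hint i j]
    refine Finset.sum_congr rfl fun j _ => ?_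
    rw [integral_const_mul]
    simp only [secondMoment, Matrix.of_apply, mul_comm]
  · rw [hexp]
    exact integrable_finsetSum _ fun i _ => integrable_finsetSum _ fun j _ => hint i j
  · exact Filter.Eventually.of_forall fun ξ => by
      simpa using hQ.dotProduct_mulVec_nonneg ξ.ofLp

variable [DecidableEq n]

theorem enorm_sq_toEuclideanLin (A : Matrix m n ℝ) (ξ : EuclideanSpace ℝ n) :
    ‖Matrix.toEuclideanLin A ξ‖ₑ ^ 2 = ENNReal.ofReal ((A *ᵥ ξ.ofLp) ⬝ᵥ (A *ᵥ ξ.ofLp)) := by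
  rw [← ofReal_norm, ← ENNReal.ofReal_pow (norm_nonneg _), EuclideanSpace.real_norm_sq_eq]
  simp [dotProduct, sq, Matrix.toLpLin_apply]

theorem lintegral_enorm_sq_toEuclideanLin (hP : Prob2 P) (A : Matrix m n ℝ) :
    ∫⁻ ξ, ‖Matrix.toEuclideanLin A ξ‖ₑ ^ 2 ∂P =
      ENNReal.ofReal (A * secondMoment P * Aᵀ).trace := by
  have hQ : (Aᵀ * A).PosSemidef := by
    simpa using Matrix.posSemidef_conjTranspose_mul_self A
  rw [Matrix.mul_assoc, Matrix.trace_mul_comm, Matrix.mul_assoc, Matrix.trace_mul_comm,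
    ← lintegral_quadratic hP hQ]
  refine lintegral_congr fun ξ => ?_
  rw [enorm_sq_toEuclideanLin, ← Matrix.mulVec_mulVec, Matrix.dotProduct_mulVec _ Aᵀ,
    Matrix.vecMul_transpose]

theorem measurable_toEuclideanLin (A : Matrix m n ℝ) : Measurable (Matrix.toEuclideanLin A) :=
  (LinearMap.continuous_of_finiteDimensional _).measurable

theorem Prob2.map_toEuclideanLin (hP : Prob2 P) (A : Matrix m n ℝ) :
    Prob2 (P.map (Matrix.toEuclideanLin A)) := by
  have := hP.1
  refine ⟨Measure.isProbabilityMeasure_map (measurable_toEuclideanLin A).aemeasurable, ?_⟩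
  rw [memLp_map_measure_iff aestronglyMeasurable_id (measurable_toEuclideanLin A).aemeasurable]
  exact hP.2.continuousLinearMap_comp (LinearMap.toContinuousLinearMap (Matrix.toEuclideanLin A))

/-- A quadratic bound along every coupling bounds the mean over a Wasserstein ball. -/
theorem lintegral_enorm_sq_le_of_mem_ambiguitySet [DecidableEq m] {P₀ : Measure (EuclideanSpace ℝ n)} {ρ : ℝ}
    (hP₀ : Prob2 P₀) (hI : secondMoment P₀ = 1) (hP : P ∈ ambiguitySet P₀ ρ) {E : Matrix m n ℝ} {γ : ℝ} (hρ : 0 ≤ ρ)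
    (hγ : 0 < γ) (h : (γ • 1 - E * Eᵀ).PosDef) :
    ∫⁻ ξ, ‖Matrix.toEuclideanLin E ξ‖ₑ ^ 2 ∂P ≤
      ENNReal.ofReal (γ * ρ ^ 2 +
        γ * (E * Eᵀ * (γ • 1 - E * Eᵀ)⁻¹).trace) := by
  set Q := Eᵀ * (γ • 1 - E * Eᵀ)⁻¹ * E with hQdef
  have hQ : Q.PosSemidef := by
    simpa using h.inv.posSemidef.conjTranspose_mul_mul_same E
  have hb : ∀ π ∈ couplings P P₀, ∫⁻ ξ, ‖Matrix.toEuclideanLin E ξ‖ₑ ^ 2 ∂P ≤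
      ENNReal.ofReal γ * (∫⁻ z, edist z.1 z.2 ^ 2 ∂π) +
        ENNReal.ofReal γ * ENNReal.ofReal (Q * secondMoment P₀).trace := by
    rintro π ⟨h1, h2⟩
    have hmeasE : Measurable fun ξ : EuclideanSpace ℝ n => ‖Matrix.toEuclideanLin E ξ‖ₑ ^ 2 :=
      (measurable_toEuclideanLin E).enorm.pow_const 2
    have hmeasQ : Measurable fun ξ : EuclideanSpace ℝ n =>
        ENNReal.ofReal (ξ.ofLp ⬝ᵥ (Q *ᵥ ξ.ofLp)) := by
      refine ENNReal.measurable_ofReal.comp (Continuous.measurable ?_)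
      fun_prop
    rw [← lintegral_quadratic hP₀ hQ, ← lintegral_const_mul _ (by fun_prop),
      ← lintegral_const_mul _ hmeasQ, ← h1, lintegral_map hmeasE measurable_fst]
    conv_rhs => rw [← h2]
    rw [lintegral_map (hmeasQ.const_mul _) measurable_snd, ← lintegral_add_left (by fun_prop)]
    refine lintegral_mono fun z => ?_
    have hd : edist z.1 z.2 ^ 2 =
        ENNReal.ofReal ((z.1.ofLp - z.2.ofLp) ⬝ᵥ (z.1.ofLp - z.2.ofLp)) := by
      have := enorm_sq_toEuclideanLin (1 : Matrix n n ℝ) (z.1 - z.2)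
      simpa [edist_eq_enorm_sub, Matrix.toLpLin_apply] using this
    have hzQ : 0 ≤ z.2.ofLp ⬝ᵥ (Q *ᵥ z.2.ofLp) := by
      simpa using hQ.dotProduct_mulVec_nonneg z.2.ofLp
    have hzd : 0 ≤ (z.1.ofLp - z.2.ofLp) ⬝ᵥ (z.1.ofLp - z.2.ofLp) := by
      simpa using dotProduct_star_self_nonneg (z.1.ofLp - z.2.ofLp)
    simp only
    rw [enorm_sq_toEuclideanLin, hd, ← ENNReal.ofReal_mul hγ.le, ← ENNReal.ofReal_mul hγ.le,
      ← ENNReal.ofReal_add (by positivity) (by positivity)]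
    exact ENNReal.ofReal_le_ofReal (sq_error_le h hγ _ _)
  have hW : (⨅ π ∈ couplings P P₀, ∫⁻ z, edist z.1 z.2 ^ 2 ∂π) ≤ ENNReal.ofReal (ρ ^ 2) := by
    have := hP.2
    rw [W2] at this
    have h3 := ENNReal.rpow_le_rpow this (z := 2) (by norm_num)
    rw [← ENNReal.rpow_mul] at h3
    norm_num at h3
    rwa [← ENNReal.ofReal_pow hρ] at h3
  -- The bound holds for each coupling, so it passes to the infimum without an optimal coupling.
  -- Multiplication commutes with the infimum because the factor is neither `0` nor `⊤`; the inner
  -- infimum is `⊤` when `π` is not a coupling.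
  have hγ0 : ENNReal.ofReal γ ≠ 0 := by simpa using hγ
  have key : ∫⁻ ξ, ‖Matrix.toEuclideanLin E ξ‖ₑ ^ 2 ∂P ≤
      ENNReal.ofReal γ * (⨅ π ∈ couplings P P₀, ∫⁻ z, edist z.1 z.2 ^ 2 ∂π) +
        ENNReal.ofReal γ * ENNReal.ofReal (Q * secondMoment P₀).trace := by
    rw [ENNReal.mul_iInf_of_ne hγ0 ENNReal.ofReal_ne_top, ENNReal.iInf_add]
    refine le_iInf fun π => ?_
    rw [ENNReal.mul_iInf_of_ne hγ0 ENNReal.ofReal_ne_top, ENNReal.iInf_add]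
    exact le_iInf fun hπ => hb π hπ
  have htr : Q.trace = (E * Eᵀ * (γ • 1 - E * Eᵀ)⁻¹).trace := by
    rw [hQdef, Matrix.trace_mul_comm, Matrix.mul_assoc]
  rw [hI, Matrix.mul_one] at key
  rw [← htr, ENNReal.ofReal_add (by positivity) (mul_nonneg hγ.le hQ.trace_nonneg),
    ENNReal.ofReal_mul hγ.le, ENNReal.ofReal_mul hγ.le]
  exact key.trans (by gcongr)

/-- Membership of a linear image in the ambiguity ball, from the cost of the linear coupling. -/
theorem map_mem_ambiguitySet {P₀ : Measure (EuclideanSpace ℝ n)} {ρ : ℝ} (hP₀ : Prob2 P₀)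
    (hI : secondMoment P₀ = 1) (hρ : 0 ≤ ρ) {D : Matrix n n ℝ}
    (hD : (D * Dᵀ).trace ≤ ρ ^ 2) :
    P₀.map (Matrix.toEuclideanLin (1 + D)) ∈ ambiguitySet P₀ ρ := by
  refine ⟨hP₀.map_toEuclideanLin _, ?_⟩
  have hm := measurable_toEuclideanLin (1 + D)
  have hpair : Measurable fun ξ : EuclideanSpace ℝ n =>
      (Matrix.toEuclideanLin (1 + D) ξ, ξ) := hm.prodMk measurable_id
  -- The coupling pairs each point with its own image, so the displacement is `D` applied to the
  -- point.
  have hc : P₀.map (fun ξ => (Matrix.toEuclideanLin (1 + D) ξ, ξ)) ∈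
      couplings (P₀.map (Matrix.toEuclideanLin (1 + D))) P₀ := by
    refine ⟨?_, ?_⟩
    · rw [Measure.map_map measurable_fst hpair]; rfl
    · rw [Measure.map_map measurable_snd hpair]; exact Measure.map_id
  have hcost : ∫⁻ z, edist z.1 z.2 ^ 2
      ∂(P₀.map fun ξ => (Matrix.toEuclideanLin (1 + D) ξ, ξ)) ≤ ENNReal.ofReal (ρ ^ 2) := by
    rw [lintegral_map (by fun_prop) hpair]
    have := lintegral_enorm_sq_toEuclideanLin hP₀ D
    rw [hI, Matrix.mul_one] at this
    refine le_of_eq_of_le ?_ (this.trans_le (ENNReal.ofReal_le_ofReal hD))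
    refine lintegral_congr fun ξ => ?_
    simp [edist_eq_enorm_sub]
  rw [W2]
  calc _ ≤ (ENNReal.ofReal (ρ ^ 2)) ^ (1 / 2 : ℝ) :=
        ENNReal.rpow_le_rpow ((iInf₂_le _ hc).trans hcost) (by norm_num)
    _ = ENNReal.ofReal ρ := by
        rw [ENNReal.ofReal_pow hρ, ← ENNReal.rpow_natCast, ← ENNReal.rpow_mul]
        norm_num

end Moments

/-! ### Schur complements of the reduced matrix inequality. -/

section Schur

variable {m : Type*} [Fintype m] [DecidableEq m] {N X : Matrix m m ℝ} {γ : ℝ}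

/-- A null vector `v` of `γ • 1 - N` makes `(0, v)` a null vector of the whole semidefinite matrix;
its upper block then reads `γ • v = 0`. The off-diagonal blocks thus exclude the boundary case. -/
theorem posDef_of_fromBlocks_posSemidef (hγ : γ ≠ 0)
    (h : (Matrix.fromBlocks X (γ • 1) (γ • 1) (γ • 1 - N)).PosSemidef) :
    (γ • 1 - N).PosDef := by
  have h2 : (γ • 1 - N).PosSemidef :=
    h.submatrix (Sum.inr : m → m ⊕ m)
  refine Matrix.PosDef.of_dotProduct_mulVec_pos h2.1 fun {v} hv => ?_
  refine lt_of_le_of_ne (h2.dotProduct_mulVec_nonneg v) fun hz => hv ?_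
  have h3 : star (Sum.elim (0 : m → ℝ) v) ⬝ᵥ
      (Matrix.fromBlocks X (γ • 1) (γ • 1) (γ • 1 - N) *ᵥ Sum.elim (0 : m → ℝ) v) = 0 := by
    rw [hz, star_trivial, star_trivial, Matrix.fromBlocks_mulVec]
    simp
  have h4 := congrArg (· ∘ Sum.inl) (h.dotProduct_mulVec_zero_iff _ |>.1 h3)
  rw [Matrix.fromBlocks_mulVec] at h4
  simpa [Matrix.smul_mulVec, hγ] using h4

theorem trace_le_of_fromBlocks_posSemidef (hγ : γ ≠ 0)
    (h : (Matrix.fromBlocks X (γ • 1) (γ • 1) (γ • 1 - N)).PosSemidef) :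
    γ ^ 2 * ((γ • 1 - N)⁻¹).trace ≤ X.trace := by
  have hd := posDef_of_fromBlocks_posSemidef hγ h
  have := hd.isUnit.invertible
  have h1 := (Matrix.PosDef.fromBlocks₂₂ X (γ • 1) hd).1 (by simpa using h)
  have h2 := h1.trace_nonneg
  simp [Matrix.trace_sub, Matrix.trace_smul] at h2
  linarith

theorem fromBlocks_posSemidef_of_posDef (h : (γ • 1 - N).PosDef) :
    (Matrix.fromBlocks (γ ^ 2 • (γ • 1 - N)⁻¹) (γ • 1) (γ • 1) (γ • 1 - N)).PosSemidef := by
  have := h.isUnit.invertible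
  have h1 := (Matrix.PosDef.fromBlocks₂₂ (γ ^ 2 • (γ • 1 - N)⁻¹) (γ • 1) h).2
    (by simpa [smul_smul, sq] using Matrix.PosSemidef.zero)
  simpa using h1

end Schur

/-! ### Completing the square in the filter, and reduction of the matrix inequality. -/

section Gram

variable {dx dw dy ds : ℕ} (S : StateSpace dx dw dy ds) (T : ℕ)

theorem one_add_mul_transpose_posDef {p q : Type*} [Fintype p] [DecidableEq p] [Fintype q]
    (H : Matrix p q ℝ) : (1 + H * Hᵀ).PosDef := by
  have := Matrix.posSemidef_self_mul_conjTranspose H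
  rw [Matrix.conjTranspose_eq_transpose_of_trivial] at this
  exact Matrix.PosDef.one.add_posSemidef this

theorem inv_one_add_transpose_mul {p q : Type*} [Fintype p] [DecidableEq p] [Fintype q]
    [DecidableEq q] (H : Matrix p q ℝ) :
    (1 + Hᵀ * H)⁻¹ = 1 - Hᵀ * (1 + H * Hᵀ)⁻¹ * H := by
  have hS : (1 + H * Hᵀ) * (1 + H * Hᵀ)⁻¹ = 1 := Matrix.mul_nonsing_inv _
    ((Matrix.isUnit_iff_isUnit_det _).1 (one_add_mul_transpose_posDef H).isUnit)
  apply Matrix.inv_eq_right_inv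
  have h1 : (1 + Hᵀ * H) * (Hᵀ * (1 + H * Hᵀ)⁻¹ * H) = Hᵀ * H := by
    calc _ = Hᵀ * ((1 + H * Hᵀ) * (1 + H * Hᵀ)⁻¹) * H := by
          simp only [Matrix.mul_add, Matrix.add_mul, Matrix.mul_assoc, Matrix.one_mul]
      _ = _ := by rw [hS, Matrix.mul_one]
  rw [Matrix.mul_sub, Matrix.mul_one, h1, add_sub_cancel_right]

/-- Completion of squares for the error Gram matrix. -/
theorem errorOp_mul_transpose (K : Matrix (SigIdx T ds) (SigIdx T dy) ℝ) :
    errorOp S T K * (errorOp S T K)ᵀ = noncausalErrorGram S T +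
      (K - noncausalEstimator S T) * (1 + measOp S T * (measOp S T)ᵀ) *
        (K - noncausalEstimator S T)ᵀ := by
  rw [errorOp, noncausalErrorGram, inv_one_add_transpose_mul, noncausalEstimator]
  set H := measOp S T
  set L := targetOp S T
  have hpd := one_add_mul_transpose_posDef H
  have hu := (Matrix.isUnit_iff_isUnit_det _).1 hpd.isUnit
  have hWt : ((1 + H * Hᵀ)⁻¹)ᵀ = (1 + H * Hᵀ)⁻¹ := by
    have := hpd.inv.1
    rwa [Matrix.IsHermitian, Matrix.conjTranspose_eq_transpose_of_trivial] at this
  have e1 : L * Hᵀ * (1 + H * Hᵀ)⁻¹ * (1 + H * Hᵀ) = L * Hᵀ := by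
    rw [Matrix.mul_assoc, Matrix.nonsing_inv_mul _ hu, Matrix.mul_one]
  have e2 : (1 + H * Hᵀ) * (L * Hᵀ * (1 + H * Hᵀ)⁻¹)ᵀ = H * Lᵀ := by
    rw [Matrix.transpose_mul, Matrix.transpose_mul, Matrix.transpose_transpose, hWt,
      ← Matrix.mul_assoc, Matrix.mul_nonsing_inv _ hu, Matrix.one_mul]
  have e3 : (K - L * Hᵀ * (1 + H * Hᵀ)⁻¹) * (1 + H * Hᵀ) *
      (K - L * Hᵀ * (1 + H * Hᵀ)⁻¹)ᵀ =
      K * (1 + H * Hᵀ) * Kᵀ - K * (H * Lᵀ) - L * Hᵀ * Kᵀ +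
        L * Hᵀ * (1 + H * Hᵀ)⁻¹ * H * Lᵀ := by
    rw [Matrix.sub_mul, e1, Matrix.transpose_sub, Matrix.mul_sub, Matrix.sub_mul, Matrix.sub_mul,
      Matrix.mul_assoc K _ (L * Hᵀ * (1 + H * Hᵀ)⁻¹)ᵀ, e2, Matrix.transpose_mul (L * Hᵀ), hWt, Matrix.transpose_mul L,
      Matrix.transpose_transpose]
    simp only [Matrix.mul_assoc]
    abel
  rw [e3, Matrix.transpose_fromCols, Matrix.fromCols_mul_fromRows]
  simp only [Matrix.mul_add, Matrix.add_mul, Matrix.mul_sub, Matrix.sub_mul, Matrix.mul_one,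
    Matrix.transpose_sub, Matrix.transpose_mul, Matrix.mul_assoc]
  abel

theorem errorOp_gram_posSemidef (K : Matrix (SigIdx T ds) (SigIdx T dy) ℝ) :
    (errorOp S T K * (errorOp S T K)ᵀ).PosSemidef := by
  simpa using Matrix.posSemidef_self_mul_conjTranspose (errorOp S T K)

/-- Take the Schur complement of the last diagonal block. Its inverse is `1 + H * Hᵀ`, so the
subtracted term is the quadratic part of `errorOp_mul_transpose`; reassociating the index sum groups
the first two blocks. -/
theorem lmiMatrix_posSemidef_iff (K : Matrix (SigIdx T ds) (SigIdx T dy) ℝ) (γ : ℝ)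
    (X : Matrix (SigIdx T ds) (SigIdx T ds) ℝ) :
    (lmiMatrix S T K γ X).PosSemidef ↔
      (Matrix.fromBlocks X (γ • 1) (γ • 1)
        (γ • 1 - errorOp S T K * (errorOp S T K)ᵀ)).PosSemidef := by
  have hpd := one_add_mul_transpose_posDef (measOp S T)
  have hinv := hpd.inv
  have := hinv.isUnit.invertible
  set Δ := K - noncausalEstimator S T with hΔ
  set W := (1 + measOp S T * (measOp S T)ᵀ)⁻¹ with hW
  have hWinv : W⁻¹ = 1 + measOp S T * (measOp S T)ᵀ :=
    Matrix.nonsing_inv_nonsing_inv _ ((Matrix.isUnit_iff_isUnit_det _).1 hpd.isUnit)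
  have hsub : (lmiMatrix S T K γ X).submatrix (Equiv.sumAssoc _ _ _) (Equiv.sumAssoc _ _ _) =
      Matrix.fromBlocks
        (Matrix.fromBlocks X (γ • 1) (γ • 1) (γ • 1 - noncausalErrorGram S T))
        (Matrix.fromRows 0 Δ) (Matrix.fromRows 0 Δ)ᴴ W := by
    ext ((i | i) | i) ((j | j) | j) <;> rfl
  rw [← Matrix.posSemidef_submatrix_equiv (Equiv.sumAssoc _ _ _), hsub,
    Matrix.PosDef.fromBlocks₂₂ _ _ hinv, hWinv]
  have hfin : Matrix.fromBlocks X (γ • 1) (γ • 1) (γ • 1 - noncausalErrorGram S T) -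
      Matrix.fromRows (0 : Matrix (SigIdx T ds) (SigIdx T dy) ℝ) Δ *
        (1 + measOp S T * (measOp S T)ᵀ) *
        (Matrix.fromRows (0 : Matrix (SigIdx T ds) (SigIdx T dy) ℝ) Δ)ᴴ =
      Matrix.fromBlocks X (γ • 1) (γ • 1)
        (γ • 1 - errorOp S T K * (errorOp S T K)ᵀ) := by
    rw [errorOp_mul_transpose, ← hΔ, Matrix.conjTranspose_eq_transpose_of_trivial,
      Matrix.transpose_fromRows, Matrix.fromRows_mul, Matrix.fromRows_mul_fromCols]
    ext (i | i) (j | j) <;> simp [sub_sub]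
  rw [hfin]

end Gram

/-! ### Strong duality and comparison with the program, filter by filter. -/

section Duality

variable {dx dw dy ds T : ℕ} {S : StateSpace dx dw dy ds} {ρ : ℝ}
  {P₀ : Measure (EuclideanSpace ℝ (DistIdx T dx dw dy))}
  {K : Matrix (SigIdx T ds) (SigIdx T dy) ℝ} {γ : ℝ} {X : Matrix (SigIdx T ds) (SigIdx T ds) ℝ}

/-- The scalar dual function of the worst-case error problem with error Gram matrix `N`. -/
noncomputable def dualValue {m : Type*} [Fintype m] [DecidableEq m] (N : Matrix m m ℝ)
    (ρ γ : ℝ) : ℝ :=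
  γ * ρ ^ 2 + γ * (N * (γ • 1 - N)⁻¹).trace

theorem mse_le_worstCaseMSE {P : Measure (EuclideanSpace ℝ (DistIdx T dx dw dy))}
    (hP : P ∈ ambiguitySet P₀ ρ) : mse S T K P ≤ worstCaseMSE S T P₀ ρ K :=
  le_iSup₂ (f := fun P _ => mse S T K P) P hP

theorem worstCaseMSE_le_dualValue (hP₀ : Prob2 P₀) (hI : secondMoment P₀ = 1) (hρ : 0 ≤ ρ)
    (hγ : 0 < γ) (h : (γ • 1 - errorOp S T K * (errorOp S T K)ᵀ).PosDef) :
    worstCaseMSE S T P₀ ρ K ≤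
      ENNReal.ofReal (dualValue (errorOp S T K * (errorOp S T K)ᵀ) ρ γ) :=
  iSup₂_le fun _ hP => lintegral_enorm_sq_le_of_mem_ambiguitySet hP₀ hI hP hρ hγ h

theorem worstCaseLaw_eq (hγ : γ ≠ 0) (h : (γ • 1 - errorOp S T K * (errorOp S T K)ᵀ).PosDef) :
    worstCaseLaw S T P₀ K γ = P₀.map (Matrix.toEuclideanLin
      (1 + (errorOp S T K)ᵀ * (γ • 1 - errorOp S T K * (errorOp S T K)ᵀ)⁻¹ * errorOp S T K)) := by
  rw [worstCaseLaw, shiftMatrix, inv_shift hγ h]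

theorem worstCaseLaw_mem_ambiguitySet (hP₀ : Prob2 P₀) (hI : secondMoment P₀ = 1) (hρ : 0 ≤ ρ)
    (hγ : γ ≠ 0) (h : (γ • 1 - errorOp S T K * (errorOp S T K)ᵀ).PosDef)
    (hst : ((errorOp S T K * (errorOp S T K)ᵀ *
        (γ • 1 - errorOp S T K * (errorOp S T K)ᵀ)⁻¹) *
      (errorOp S T K * (errorOp S T K)ᵀ *
        (γ • 1 - errorOp S T K * (errorOp S T K)ᵀ)⁻¹)).trace = ρ ^ 2) :
    worstCaseLaw S T P₀ K γ ∈ ambiguitySet P₀ ρ := by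
  rw [worstCaseLaw_eq hγ h]
  refine map_mem_ambiguitySet hP₀ hI hρ ?_
  rw [trace_shift_cost h, hst]

theorem mse_worstCaseLaw (hP₀ : Prob2 P₀) (hI : secondMoment P₀ = 1)
    (hγ : γ ≠ 0) (h : (γ • 1 - errorOp S T K * (errorOp S T K)ᵀ).PosDef)
    (hst : ((errorOp S T K * (errorOp S T K)ᵀ *
        (γ • 1 - errorOp S T K * (errorOp S T K)ᵀ)⁻¹) *
      (errorOp S T K * (errorOp S T K)ᵀ *
        (γ • 1 - errorOp S T K * (errorOp S T K)ᵀ)⁻¹)).trace = ρ ^ 2) :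
    mse S T K (worstCaseLaw S T P₀ K γ) =
      ENNReal.ofReal (dualValue (errorOp S T K * (errorOp S T K)ᵀ) ρ γ) := by
  have h1 := lintegral_enorm_sq_toEuclideanLin hP₀ (errorOp S T K *
    (1 + (errorOp S T K)ᵀ * (γ • 1 - errorOp S T K * (errorOp S T K)ᵀ)⁻¹ * errorOp S T K))
  rw [hI, Matrix.mul_one, trace_shift_error h, hst, mul_add] at h1
  rw [dualValue, ← h1, mse, worstCaseLaw_eq hγ h,
    lintegral_map ((measurable_toEuclideanLin (errorOp S T K)).enorm.pow_const 2) (measurable_toEuclideanLin _)]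
  refine lintegral_congr fun ξ => ?_
  simp only [Matrix.toLpLin_apply, Matrix.mulVec_mulVec]

/-- Strong duality, at a stationary multiplier. -/
theorem worstCaseMSE_eq_dualValue (hP₀ : Prob2 P₀) (hI : secondMoment P₀ = 1) (hρ : 0 ≤ ρ)
    (hγ : 0 < γ) (h : (γ • 1 - errorOp S T K * (errorOp S T K)ᵀ).PosDef)
    (hst : ((errorOp S T K * (errorOp S T K)ᵀ *
        (γ • 1 - errorOp S T K * (errorOp S T K)ᵀ)⁻¹) *
      (errorOp S T K * (errorOp S T K)ᵀ *
        (γ • 1 - errorOp S T K * (errorOp S T K)ᵀ)⁻¹)).trace = ρ ^ 2) :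
    worstCaseMSE S T P₀ ρ K =
      ENNReal.ofReal (dualValue (errorOp S T K * (errorOp S T K)ᵀ) ρ γ) :=
  le_antisymm (worstCaseMSE_le_dualValue hP₀ hI hρ hγ h)
    ((mse_worstCaseLaw hP₀ hI hγ.ne' h hst).symm.le.trans
      (mse_le_worstCaseMSE (worstCaseLaw_mem_ambiguitySet hP₀ hI hρ hγ.ne' h hst)))

/-- By cyclicity the trace in the dual value is that of the semidefinite matrix `Eᵀ * R * E`. -/
theorem mul_sq_le_dualValue (hγ : 0 ≤ γ)
    (h : (γ • 1 - errorOp S T K * (errorOp S T K)ᵀ).PosDef) :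
    γ * ρ ^ 2 ≤ dualValue (errorOp S T K * (errorOp S T K)ᵀ) ρ γ := by
  have hQ : ((errorOp S T K)ᵀ * (γ • 1 - errorOp S T K * (errorOp S T K)ᵀ)⁻¹ *
      errorOp S T K).PosSemidef := by
    simpa using h.inv.posSemidef.conjTranspose_mul_mul_same (errorOp S T K)
  have := hQ.trace_nonneg
  rw [Matrix.mul_assoc, Matrix.trace_mul_comm, Matrix.mul_assoc, Matrix.trace_mul_comm] at this
  exact le_add_of_nonneg_right (mul_nonneg hγ this)

theorem SDPFeasible.posDef (h : SDPFeasible S T K γ X) (hγ : 0 < γ) :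
    (γ • 1 - errorOp S T K * (errorOp S T K)ᵀ).PosDef :=
  posDef_of_fromBlocks_posSemidef hγ.ne' ((lmiMatrix_posSemidef_iff S T K γ X).1 h.2.2.2)

theorem SDPFeasible.dualValue_le (h : SDPFeasible S T K γ X) (hγ : 0 < γ) :
    dualValue (errorOp S T K * (errorOp S T K)ᵀ) ρ γ ≤ sdpObjective ρ γ X := by
  have h1 := trace_le_of_fromBlocks_posSemidef hγ.ne'
    ((lmiMatrix_posSemidef_iff S T K γ X).1 h.2.2.2)
  rw [dualValue, sdpObjective, trace_mul_resolvent (h.posDef hγ)]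
  nlinarith [h1]

theorem sdpFeasible_of_posDef (hK : K ∈ causalFilters T dy ds) (hγ : 0 ≤ γ)
    (h : (γ • 1 - errorOp S T K * (errorOp S T K)ᵀ).PosDef) :
    SDPFeasible S T K γ (γ ^ 2 • (γ • 1 - errorOp S T K * (errorOp S T K)ᵀ)⁻¹) :=
  ⟨hK, hγ, h.inv.posSemidef.smul (sq_nonneg γ),
    (lmiMatrix_posSemidef_iff S T K γ _).2 (fromBlocks_posSemidef_of_posDef h)⟩

theorem sdpObjective_resolvent (h : (γ • 1 - errorOp S T K * (errorOp S T K)ᵀ).PosDef) :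
    sdpObjective ρ γ (γ ^ 2 • (γ • 1 - errorOp S T K * (errorOp S T K)ᵀ)⁻¹) =
      dualValue (errorOp S T K * (errorOp S T K)ᵀ) ρ γ := by
  rw [dualValue, sdpObjective, trace_mul_resolvent h, Matrix.trace_smul, smul_eq_mul]
  ring

/-- With a zero multiplier the lower block is minus a Gram matrix; being semidefinite, it forces the
squared Frobenius norm of the error operator to vanish. -/
theorem SDPFeasible.errorOp_eq_zero (h : SDPFeasible S T K 0 X) : errorOp S T K = 0 := by
  have h1 := (lmiMatrix_posSemidef_iff S T K 0 X).1 h.2.2.2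
  have h2 : ((0 : ℝ) • 1 - errorOp S T K * (errorOp S T K)ᵀ).PosSemidef :=
    h1.submatrix (Sum.inr : _ → SigIdx T ds ⊕ SigIdx T ds)
  have h3 := h2.trace_nonneg
  have h4 := (errorOp_gram_posSemidef S T K).trace_nonneg
  rw [zero_smul, zero_sub, Matrix.trace_neg] at h3
  have h5 : (errorOp S T K * (errorOp S T K)ᴴ).trace = 0 := by
    rw [Matrix.conjTranspose_eq_transpose_of_trivial]; linarith
  exact Matrix.trace_mul_conjTranspose_self_eq_zero_iff.1 h5

theorem sdpFeasible_zero (hK : K ∈ causalFilters T dy ds) (h : errorOp S T K = 0) :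
    SDPFeasible S T K 0 0 := by
  refine ⟨hK, le_rfl, Matrix.PosSemidef.zero, (lmiMatrix_posSemidef_iff S T K 0 0).2 ?_⟩
  simpa [h] using Matrix.PosSemidef.zero

theorem errorOp_eq_zero_of_gram (h : errorOp S T K * (errorOp S T K)ᵀ = 0) :
    errorOp S T K = 0 := by
  apply Matrix.trace_mul_conjTranspose_self_eq_zero_iff.1
  rw [Matrix.conjTranspose_eq_transpose_of_trivial, h, Matrix.trace_zero]

theorem worstCaseMSE_eq_zero (h : errorOp S T K = 0) : worstCaseMSE S T P₀ ρ K = 0 := by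
  simp [worstCaseMSE, mse, h]

/-- Needed because `ENNReal.ofReal` reflects comparisons of objectives only when they are
nonnegative. -/
theorem SDPFeasible.objective_nonneg (h : SDPFeasible S T K γ X) : 0 ≤ sdpObjective ρ γ X := by
  rcases h.2.1.eq_or_lt with h0 | hγ
  · rw [sdpObjective, ← h0, zero_mul, zero_add]
    exact h.2.2.1.trace_nonneg
  · exact (mul_nonneg hγ.le (sq_nonneg ρ)).trans
      ((mul_sq_le_dualValue hγ.le (h.posDef hγ)).trans (h.dualValue_le hγ))

/-- Every feasible point of the program bounds the worst-case error of its filter. -/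
theorem SDPFeasible.worstCaseMSE_le (hP₀ : Prob2 P₀) (hI : secondMoment P₀ = 1) (hρ : 0 ≤ ρ)
    (h : SDPFeasible S T K γ X) :
    worstCaseMSE S T P₀ ρ K ≤ ENNReal.ofReal (sdpObjective ρ γ X) := by
  rcases h.2.1.eq_or_lt with h0 | hγ
  · subst h0
    rw [worstCaseMSE_eq_zero h.errorOp_eq_zero]
    exact zero_le
  · exact (worstCaseMSE_le_dualValue hP₀ hI hρ hγ (h.posDef hγ)).trans
      (ENNReal.ofReal_le_ofReal (h.dualValue_le hγ))

/-- The worst-case error of a causal filter is attained by the program. -/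
theorem exists_sdpFeasible_worstCaseMSE_eq (hP₀ : Prob2 P₀) (hI : secondMoment P₀ = 1)
    (hρ : 0 < ρ) (hK : K ∈ causalFilters T dy ds) :
    ∃ γ X, SDPFeasible S T K γ X ∧
      worstCaseMSE S T P₀ ρ K = ENNReal.ofReal (sdpObjective ρ γ X) := by
  by_cases h0 : errorOp S T K * (errorOp S T K)ᵀ = 0
  · have hE := errorOp_eq_zero_of_gram h0
    refine ⟨0, 0, sdpFeasible_zero hK hE, ?_⟩
    rw [worstCaseMSE_eq_zero hE]
    simp [sdpObjective]
  · obtain ⟨γ, hγ, hpd, hst⟩ := exists_multiplier (errorOp_gram_posSemidef S T K) h0 hρ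
    refine ⟨γ, _, sdpFeasible_of_posDef hK hγ.le hpd, ?_⟩
    rw [sdpObjective_resolvent hpd, worstCaseMSE_eq_dualValue hP₀ hI hρ.le hγ hpd hst]

/-- The multiplier of an optimal solution is stationary, unless it vanishes. -/
theorem SDPOptimal.stationary (hρ : 0 < ρ) (h : SDPOptimal S T ρ K γ X) (hγ : 0 < γ) :
    ((errorOp S T K * (errorOp S T K)ᵀ *
        (γ • 1 - errorOp S T K * (errorOp S T K)ᵀ)⁻¹) *
      (errorOp S T K * (errorOp S T K)ᵀ *
        (γ • 1 - errorOp S T K * (errorOp S T K)ᵀ)⁻¹)).trace = ρ ^ 2 := by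
  have hpd := h.1.posDef hγ
  have hle := h.1.dualValue_le (ρ := ρ) hγ
  -- With a zero Gram matrix the same filter would be feasible at `γ = 0` with objective `0`,
  -- beating the current value, which is at least `γ * ρ ^ 2 > 0`.
  have h0 : errorOp S T K * (errorOp S T K)ᵀ ≠ 0 := fun h0 => by
    have h1 := h.2 K 0 0 (sdpFeasible_zero h.1.1 (errorOp_eq_zero_of_gram h0))
    have h2 := mul_sq_le_dualValue (ρ := ρ) hγ.le hpd
    have h3 : 0 < γ * ρ ^ 2 := by positivity
    simp only [sdpObjective, zero_mul, Matrix.trace_zero, add_zero] at h1 hle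
    linarith
  obtain ⟨γ', hγ', hpd', hst⟩ := exists_multiplier (errorOp_gram_posSemidef S T K) h0 hρ
  have h1 := h.2 K γ' _ (sdpFeasible_of_posDef h.1.1 hγ'.le hpd')
  rw [sdpObjective_resolvent hpd'] at h1
  rwa [multiplier_unique (errorOp_gram_posSemidef S T K) hρ hpd hpd' hst (hle.trans h1)]

end Duality

/-! ### Existence of an optimal filter and transfer of optimality. -/

section Existence

variable {dx dw dy ds T : ℕ} {S : StateSpace dx dw dy ds} {ρ : ℝ}
  {P₀ : Measure (EuclideanSpace ℝ (DistIdx T dx dw dy))}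

theorem continuous_errorOp : Continuous (errorOp S T) := by
  refine continuous_pi fun i => continuous_pi fun j => ?_
  rcases j with j | j
  · simp only [errorOp, Matrix.fromCols_apply_inl, Matrix.sub_apply, Matrix.mul_apply]
    fun_prop
  · simp only [errorOp, Matrix.fromCols_apply_inr]
    fun_prop

theorem continuous_mse {P : Measure (EuclideanSpace ℝ (DistIdx T dx dw dy))} (hP : Prob2 P) :
    Continuous fun K => mse S T K P := by
  simp only [mse, lintegral_enorm_sq_toEuclideanLin hP]
  refine ENNReal.continuous_ofReal.comp (Continuous.matrix_trace ?_)
  exact (continuous_errorOp.matrix_mul continuous_const).matrix_mul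
    continuous_errorOp.matrix_transpose

theorem lowerSemicontinuous_worstCaseMSE : LowerSemicontinuous (worstCaseMSE S T P₀ ρ) :=
  lowerSemicontinuous_biSup fun _ hP => (continuous_mse hP.1).lowerSemicontinuous

theorem self_mem_ambiguitySet (hP₀ : Prob2 P₀) (hI : secondMoment P₀ = 1) (hρ : 0 ≤ ρ) :
    P₀ ∈ ambiguitySet P₀ ρ := by
  have := map_mem_ambiguitySet hP₀ hI hρ (D := 0) (by simpa using sq_nonneg ρ)
  rw [add_zero, Matrix.toLpLin_one] at this
  rwa [show ((LinearMap.id : EuclideanSpace ℝ (DistIdx T dx dw dy) →ₗ[ℝ] _) : _ → _) = id from rfl,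
    Measure.map_id] at this

/-- Coercivity: the nominal law lies in the ball, and its isotropy makes the error the squared
Frobenius norm of the error operator, which contains `K` as a block. -/
theorem sq_entry_le_worstCaseMSE (hP₀ : Prob2 P₀) (hI : secondMoment P₀ = 1) (hρ : 0 ≤ ρ)
    (K : Matrix (SigIdx T ds) (SigIdx T dy) ℝ) (i : SigIdx T ds) (j : SigIdx T dy) :
    ENNReal.ofReal (K i j ^ 2) ≤ worstCaseMSE S T P₀ ρ K := by
  refine le_trans ?_ (mse_le_worstCaseMSE (self_mem_ambiguitySet hP₀ hI hρ))
  rw [mse, lintegral_enorm_sq_toEuclideanLin hP₀, hI, Matrix.mul_one]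
  apply ENNReal.ofReal_le_ofReal
  have htr : (errorOp S T K * (errorOp S T K)ᵀ).trace = ∑ a, ∑ b, errorOp S T K a b ^ 2 := by
    simp [Matrix.trace, Matrix.mul_apply, sq]
  rw [htr]
  calc K i j ^ 2 = errorOp S T K i (Sum.inr j) ^ 2 := rfl
    _ ≤ ∑ b, errorOp S T K i b ^ 2 :=
      Finset.single_le_sum (f := fun b => errorOp S T K i b ^ 2) (fun _ _ => sq_nonneg _)
        (Finset.mem_univ _)
    _ ≤ _ := Finset.single_le_sum (f := fun a => ∑ b, errorOp S T K a b ^ 2)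
        (fun _ _ => Finset.sum_nonneg fun _ _ => sq_nonneg _) (Finset.mem_univ i)

theorem isClosed_causalFilters : IsClosed (causalFilters T dy ds) := by
  simp only [causalFilters, Set.ofPred_forall]
  refine isClosed_iInter fun t => isClosed_iInter fun s => isClosed_iInter fun i =>
    isClosed_iInter fun j => isClosed_iInter fun _ => isClosed_eq ?_ continuous_const
  exact (continuous_apply (s, j)).comp (continuous_apply (t, i))

theorem exists_isOptimalFilter (hP₀ : Prob2 P₀) (hI : secondMoment P₀ = 1) (hρ : 0 < ρ) :
    ∃ K : Matrix (SigIdx T ds) (SigIdx T dy) ℝ, IsOptimalFilter S T P₀ ρ K := by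
  have h0c : (0 : Matrix (SigIdx T ds) (SigIdx T dy) ℝ) ∈ causalFilters T dy ds :=
    fun _ _ _ _ _ => rfl
  obtain ⟨γ, X, hf, hv⟩ := exists_sdpFeasible_worstCaseMSE_eq (S := S) hP₀ hI hρ h0c
  set c := sdpObjective ρ γ X
  have hc : 0 ≤ c := hf.objective_nonneg
  -- Here `c` is the worst-case error of the zero filter. A filter outside this box has an entry
  -- whose square is at least `c`, so it does no better than zero, which lies inside.
  let B : Set (Matrix (SigIdx T ds) (SigIdx T dy) ℝ) :=
    Set.univ.pi fun _ => Set.univ.pi fun _ => Set.Icc (-√c) √c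
  have hB : IsCompact B := isCompact_univ_pi fun _ => isCompact_univ_pi fun _ => isCompact_Icc
  have h0B : (0 : Matrix (SigIdx T ds) (SigIdx T dy) ℝ) ∈ B := fun _ _ _ _ => by simp
  obtain ⟨K, hK, hmin⟩ := LowerSemicontinuousOn.exists_isMinOn
    (s := causalFilters T dy ds ∩ B) ⟨0, h0c, h0B⟩ (hB.inter_left isClosed_causalFilters)
    (lowerSemicontinuous_worstCaseMSE (S := S) (P₀ := P₀) (ρ := ρ) |>.lowerSemicontinuousOn _)
  refine ⟨K, hK.1, fun K' hK' => ?_⟩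
  by_cases hB' : K' ∈ B
  · exact hmin ⟨hK', hB'⟩
  · have : ∃ i j, K' i j ∉ Set.Icc (-√c) √c := by
      by_contra! hall
      exact hB' fun i _ j _ => hall i j
    obtain ⟨i, j, hij⟩ := this
    have hlt : c ≤ K' i j ^ 2 := by
      by_contra! hlt
      exact hij (abs_le.1 (Real.abs_le_sqrt hlt.le))
    exact (hmin ⟨h0c, h0B⟩ : worstCaseMSE S T P₀ ρ K ≤ worstCaseMSE S T P₀ ρ 0).trans
      (hv.le.trans ((ENNReal.ofReal_le_ofReal hlt).trans
        (sq_entry_le_worstCaseMSE hP₀ hI hρ.le K' i j)))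

theorem IsOptimalFilter.exists_sdpOptimal (hP₀ : Prob2 P₀) (hI : secondMoment P₀ = 1)
    (hρ : 0 < ρ) {K : Matrix (SigIdx T ds) (SigIdx T dy) ℝ} (h : IsOptimalFilter S T P₀ ρ K) :
    ∃ γ X, SDPOptimal S T ρ K γ X ∧
      worstCaseMSE S T P₀ ρ K = ENNReal.ofReal (sdpObjective ρ γ X) := by
  obtain ⟨γ, X, hf, hv⟩ := exists_sdpFeasible_worstCaseMSE_eq (S := S) hP₀ hI hρ h.1
  refine ⟨γ, X, ⟨hf, fun K' γ' X' hf' => ?_⟩, hv⟩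
  have h1 := (h.2 K' hf'.1).trans (hf'.worstCaseMSE_le hP₀ hI hρ.le)
  rw [hv] at h1
  exact (ENNReal.ofReal_le_ofReal_iff hf'.objective_nonneg).1 h1

theorem SDPOptimal.isOptimalFilter (hP₀ : Prob2 P₀) (hI : secondMoment P₀ = 1)
    (hρ : 0 < ρ) {K : Matrix (SigIdx T ds) (SigIdx T dy) ℝ} {γ : ℝ}
    {X : Matrix (SigIdx T ds) (SigIdx T ds) ℝ} (h : SDPOptimal S T ρ K γ X) :
    IsOptimalFilter S T P₀ ρ K := by
  refine ⟨h.1.1, fun K' hK' => ?_⟩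
  obtain ⟨γ', X', hf, hv⟩ := exists_sdpFeasible_worstCaseMSE_eq (S := S) hP₀ hI hρ hK'
  rw [hv]
  exact (h.1.worstCaseMSE_le hP₀ hI hρ.le).trans (ENNReal.ofReal_le_ofReal (h.2 _ _ _ hf))

/-- A zero multiplier kills the error operator, hence `K` and then the target operator, whose block
at time `0` acting on the initial state is `Cs` itself; this uses `0 < T`. -/
theorem SDPFeasible.multiplier_pos (hT : 0 < T) {K : Matrix (SigIdx T ds) (SigIdx T dy) ℝ}
    {γ : ℝ} {X : Matrix (SigIdx T ds) (SigIdx T ds) ℝ} (h : SDPFeasible S T K γ X)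
    (hC : S.Cs ≠ 0) : 0 < γ := by
  refine lt_of_le_of_ne h.2.1 fun h0 => hC ?_
  subst h0
  have hE := h.errorOp_eq_zero
  have hK : K = 0 := by
    ext i j; exact congrFun (congrFun hE i) (Sum.inr j)
  have hL : targetOp S T = 0 := by
    ext i j
    have : (K * measOp S T - targetOp S T) i j = 0 := congrFun (congrFun hE i) (Sum.inl j)
    simpa [hK] using this
  ext i j
  have : targetOp S T (⟨0, hT⟩, i) (Sum.inl j) = 0 := by rw [hL]; rfl
  simpa [targetOp, outputMatrix] using this

end Existence

end DRFilter
-- Assembly of the theorem.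
theorem theorem3p4 {dx dw dy ds : ℕ} (S : DRFilter.StateSpace dx dw dy ds) (T : ℕ) (hT : 0 < T)
    (ρ : ℝ) (hρ : 0 < ρ)
    (P₀ : Measure (EuclideanSpace ℝ (DRFilter.DistIdx T dx dw dy)))
    (hP₀ : DRFilter.Prob2 P₀)
    (hI : ∀ i j, ∫ ξ, ξ i * ξ j ∂P₀ =
      (1 : Matrix (DRFilter.DistIdx T dx dw dy) (DRFilter.DistIdx T dx dw dy) ℝ) i j) :
    -- the filtering problem and the semidefinite program have the same optimal value
    (((⨅ K ∈ DRFilter.causalFilters T dy ds, DRFilter.worstCaseMSE S T P₀ ρ K : ℝ≥0∞) : EReal) =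
      ⨅ (K : Matrix (DRFilter.SigIdx T ds) (DRFilter.SigIdx T dy) ℝ) (γ : ℝ)
        (X : Matrix (DRFilter.SigIdx T ds) (DRFilter.SigIdx T ds) ℝ)
        (_ : DRFilter.SDPFeasible S T K γ X), ((DRFilter.sdpObjective ρ γ X : ℝ) : EReal)) ∧
    -- the semidefinite program has an optimal solution
    (∃ K γ X, DRFilter.SDPOptimal S T ρ K γ X) ∧
    -- its optimal filters are the solutions of the filtering problem
    (∀ K, DRFilter.IsOptimalFilter S T P₀ ρ K ↔ ∃ γ X, DRFilter.SDPOptimal S T ρ K γ X) ∧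
    -- the worst-case disturbance at an optimal solution
    (∀ K γ X, DRFilter.SDPOptimal S T ρ K γ X →
      (S.Cs ≠ 0 → 0 < γ) ∧
      (0 < γ →
        (DRFilter.shiftMatrix S T K γ).PosDef ∧
        DRFilter.worstCaseLaw S T P₀ K γ ∈ DRFilter.ambiguitySet P₀ ρ ∧
        DRFilter.mse S T K (DRFilter.worstCaseLaw S T P₀ K γ) =
          DRFilter.worstCaseMSE S T P₀ ρ K)) := by
  have hM : DRFilter.secondMoment P₀ = 1 := by
    ext i j
    exact hI i j
  obtain ⟨K₁, hK₁⟩ := DRFilter.exists_isOptimalFilter (S := S) (ds := ds) hP₀ hM hρ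
  obtain ⟨γ₁, X₁, h₁, hv₁⟩ := hK₁.exists_sdpOptimal hP₀ hM hρ
  refine ⟨?_, ⟨K₁, γ₁, X₁, h₁⟩, fun K => ⟨fun h => ?_, ?_⟩, fun K γ X h =>
    ⟨h.1.multiplier_pos hT, fun hγ => ?_⟩⟩
  · have hinf : (⨅ K ∈ DRFilter.causalFilters T dy ds, DRFilter.worstCaseMSE S T P₀ ρ K) =
        ENNReal.ofReal (DRFilter.sdpObjective ρ γ₁ X₁) := by
      rw [← hv₁]
      exact le_antisymm (iInf₂_le K₁ hK₁.1) (le_iInf₂ hK₁.2)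
    -- Nonnegativity of the optimal objective removes the truncation at zero in passing to `EReal`.
    rw [hinf, EReal.coe_ennreal_ofReal, max_eq_left h₁.1.objective_nonneg]
    refine le_antisymm ?_ ?_
    · exact le_iInf fun K => le_iInf fun γ => le_iInf fun X => le_iInf fun hf =>
        EReal.coe_le_coe_iff.2 (h₁.2 K γ X hf)
    · exact iInf_le_of_le K₁ (iInf_le_of_le γ₁ (iInf_le_of_le X₁ (iInf_le_of_le h₁.1 le_rfl)))
  · obtain ⟨γ, X, hopt, -⟩ := h.exists_sdpOptimal hP₀ hM hρ
    exact ⟨γ, X, hopt⟩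
  · rintro ⟨γ, X, h⟩
    exact h.isOptimalFilter hP₀ hM hρ
  · have hpd := h.1.posDef hγ
    have hst := h.stationary hρ hγ
    refine ⟨DRFilter.posDef_shift hγ.ne' hpd,
      DRFilter.worstCaseLaw_mem_ambiguitySet hP₀ hM hρ.le hγ.ne' hpd hst, ?_⟩
    rw [DRFilter.mse_worstCaseLaw hP₀ hM hγ.ne' hpd hst,
      DRFilter.worstCaseMSE_eq_dualValue hP₀ hM hρ.le hγ hpd hst]
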